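/- **Setting.** Let $n$ hypotheses $H_1,\dots,H_n$ be tested with $p$-values $PV_1,\dots,PV_n$ (random variables on a common probability space, with arbitrary joint dependence). Let $I\subset\{1,\dots,n\}$ be the set of true hypotheses; for $i\in I$ it is only assumed that $P(PV_i\le u)\le u$ for all $u\in(0,1)$. Let $\mathcal C=\{c\in\mathbb R^n : 0\le c_1\le\dots\le c_n\}$ and let $PV_{(1)}\le\dots\le PV_{(n)}$ be the ordered $p$-values. For $c\in\mathcal C$ the step-up procedure rejects the hypotheses belonging to $PV_{(1)},\dots,PV_{(k)}$, where $k=\max\{i : PV_{(i)}\le c_i\}$; the step-down procedure does so with $k=\max\{i : PV_{(j)}\le c_j \text{ for } j=1,\dots,i\}$ (no rejection if there is no such $i$). With $R$ the number of rejections and $V$ the number of rejected true hypotheses, $\mathrm{FDP}=V/R$ ($=0$ if $R=0$). The procedure $c\in\mathcal C$ controls the $\gamma$-FDP at level $\alpha$ if $P(\mathrm{FDP}>\gamma)\le\alpha$ for every non-empty $I$ and every joint distribution of the $p$-values as above. The average power is the expected proportion of rejected hypotheses among the false ones. For $A\in\mathbb R_+^{n\times n}$ let $\mathcal F(A)=\{c\in\mathcal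 C : \|Ac\|_\infty\le1\}$. Let $\gamma\in[0,1)$, and for integers $N\ge 1$ put $w_N(k)=\frac1k-\frac1{k+1}$ for $1\le k<N$, $w_N(N)=\frac1N$, and $w_N(k)=0$ for $k>N$. *Step-up matrix.* Let $m(j)=\lfloor\gamma j\rfloor+1$ and, for $1\le i\le n$, $\widetilde M(i)=\max\{l\in\{1,\dots,n\} : m(l)\le i\}$, $g_i(l)=\max\{i-n+l,\,m(l)\}$ for $1\le l\le\widetilde M(i)$, $M(i)=g_i(\widetilde M(i))$ and $t_k(i)=\max g_i^{-1}(\{k\})$ for $1\le k\le M(i)$. Then $A^{\mathrm{SU}}_{ij}(\gamma)=i\,w_{M(i)}(k)$ if $j=t_k(i)$ for some $1\le k\le M(i)$, and $A^{\mathrm{SU}}_{ij}(\gamma)=0$ otherwise. *Step-down matrix.* For $1\le i\le n$ and $1\le l\le\lfloor\gamma n\rfloor+1$ let $k_i(l)=\min\{n,\;n+l-i,\;\lceil l/\gamma\rceil-1\}$ (the last term being $+\infty$ if $\gamma=0$) and $N(i)=\min\{\lfloor\gamma n\rfloor+1,\;i,\;\lfloor\gamma(\frac{n-i}{1-\gamma}+1)\rfloor+1\}$.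 Then $A^{\mathrm{SD}}_{ij}(\gamma)=\sum_{l:\,k_i(l)=j} i\,w_{N(i)}(l)$. **Statement.** Let $\gamma\in[0,1)$, let $A=A^{\mathrm{SU}}(\gamma)$ or $A=A^{\mathrm{SD}}(\gamma)$, and let $c\in\mathcal F(A)$. Consider the linear program: maximise $\sum_{j=1}^n a_j\xi_j$, where $a_j=\sum_{i=1}^nA_{ij}$, subject to $(A\xi)_i\le1$ for all $i$, $0\le\xi_1\le\dots\le\xi_n$, and $\xi_i\ge c_i$ for all $i$. This program has a solution, and every solution $\xi$ satisfies $\xi\in\mathcal F(A)$. Moreover, for every $\alpha\in(0,1)$, the procedure $\alpha\xi$ (step-up if $A=A^{\mathrm{SU}}(\gamma)$, step-down if $A=A^{\mathrm{SD}}(\gamma)$) controls the $\gamma$-FDP at level $\alpha$, and it is at least as powerful as the procedure $\alpha c$ with the same direction of stepping: for every realisation of the $p$-values it rejects every hypothesis that $\alpha c$ rejects, and in particular its average power is at least that of $\alpha c$. -/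

import Mathlib

universe u

namespace MultipleTesting

noncomputable section

open MeasureTheory

/-- The two directions of stepping: step-up and step-down. -/
inductive Stepping where
  | up
  | down

/-! ### Step-up and step-down procedures

Vectors indexed by `Fin n` are 0-based: the coordinate `i : Fin n` is the mathematical index `i + 1`.
For `p : Fin n → ℝ`, `Tuple.sort p` is a permutation with `p ∘ Tuple.sort p` non-decreasing, so
`p (Tuple.sort p i)` is the ordered `p`-value with (1-based) rank `i + 1`. -/

/-- The set `𝒞` of non-negative non-decreasing vectors of critical constants. -/
def criticalConstants (n : ℕ) : Set (Fin n → ℝ) :=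
  {c | (∀ i, 0 ≤ c i) ∧ Monotone c}

/-- Number of rejections: for step-up `max {i | p_(i) ≤ c_i}`,
for step-down `max {i | p_(j) ≤ c_j for j = 1, …, i}`, and `0` if there is no such `i`. -/
def numRejections {n : ℕ} (s : Stepping) (c p : Fin n → ℝ) : ℕ :=
  match s with
  | .up => (Finset.univ.filter fun i : Fin n => p (Tuple.sort p i) ≤ c i).sup
      fun i => (i : ℕ) + 1
  | .down => (Finset.univ.filter fun i : Fin n => ∀ j ≤ i, p (Tuple.sort p j) ≤ c j).sup
      fun i => (i : ℕ) + 1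

/-- The set of rejected hypotheses: those with the `numRejections` smallest `p`-values. -/
def rejected {n : ℕ} (s : Stepping) (c p : Fin n → ℝ) : Finset (Fin n) :=
  (Finset.univ.filter fun i : Fin n => (i : ℕ) < numRejections s c p).image (Tuple.sort p)

/-- False discovery proportion `V / R` (`0` if nothing is rejected), where `I` is the set of
true hypotheses. -/
def fdp {n : ℕ} (s : Stepping) (c p : Fin n → ℝ) (I : Finset (Fin n)) : ℝ :=
  ((rejected s c p ∩ I).card : ℝ) / ((rejected s c p).card : ℝ)

/-- `PV` are random `p`-values, with arbitrary dependence, for a testing problem in which `I` is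
the set of true hypotheses: those of true hypotheses are stochastically larger than uniform. -/
structure IsPValues {n : ℕ} {Ω : Type u} [MeasurableSpace Ω] (P : Measure Ω)
    (I : Finset (Fin n)) (PV : Fin n → Ω → ℝ) : Prop where
  measurable : ∀ i, Measurable (PV i)
  le_uniform : ∀ i ∈ I, ∀ x : ℝ, 0 < x → x < 1 → P.real {ω | PV i ω ≤ x} ≤ x

/-- The step-up (step-down) procedures that strongly control the `γ`-FDP at level `α` under
arbitrary dependence: `P(FDP > γ) ≤ α` for every non-empty set of true hypotheses and every joint
distribution of the `p`-values. -/
def fdpControlling (s : Stepping) (n : ℕ) (α γ : ℝ) : Set (Fin n → ℝ) :=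
  {c | c ∈ criticalConstants n ∧
    ∀ I : Finset (Fin n), I.Nonempty →
    ∀ (Ω : Type u) [MeasurableSpace Ω] (P : Measure Ω) [IsProbabilityMeasure P]
      (PV : Fin n → Ω → ℝ), IsPValues P I PV →
      P.real {ω | γ < fdp s c (fun i => PV i ω) I} ≤ α}

/-- Average power: expected proportion of rejected hypotheses among the false ones. -/
def averagePower {n : ℕ} {Ω : Type u} [MeasurableSpace Ω] (s : Stepping) (c : Fin n → ℝ)
    (P : Measure Ω) (I : Finset (Fin n)) (PV : Fin n → Ω → ℝ) : ENNReal :=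
  ∫⁻ ω, ((rejected s c (fun i => PV i ω) \ I).card : ENNReal) / (Iᶜ.card : ENNReal) ∂P

/-- The procedure `d` is at least as powerful as `c`: whatever the observed `p`-values are, it
rejects every hypothesis that `c` rejects, and its average power is never smaller. -/
def AtLeastAsPowerful {n : ℕ} (s : Stepping) (d c : Fin n → ℝ) : Prop :=
  (∀ p : Fin n → ℝ, rejected s c p ⊆ rejected s d p) ∧
  ∀ (I : Finset (Fin n)) (Ω : Type u) [MeasurableSpace Ω] (P : Measure Ω)
    [IsProbabilityMeasure P] (PV : Fin n → Ω → ℝ), IsPValues P I PV →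
    averagePower s c P I PV ≤ averagePower s d P I PV

/-- `𝓕(A) = {c ∈ 𝒞 | ‖A c‖_∞ ≤ 1}`; the norm of `Fin n → ℝ` is the maximum norm. -/
def feasibleConstants {n : ℕ} (A : Matrix (Fin n) (Fin n) ℝ) : Set (Fin n → ℝ) :=
  {c | c ∈ criticalConstants n ∧ ‖A.mulVec c‖ ≤ 1}

/-! ### The associated matrices

The auxiliary functions below take 1-based indices `i, j, k, l ∈ {1, …, n}`. -/

/-- `1/k - 1/(k+1)` for `1 ≤ k < N`, `1/N` for `k = N`, and `0` otherwise. -/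
def stepWeight (N k : ℕ) : ℝ :=
  if 1 ≤ k ∧ k < N then 1 / (k : ℝ) - 1 / ((k : ℝ) + 1)
  else if k = N then 1 / (N : ℝ) else 0

/-- `m(j) = ⌊γ j⌋ + 1`. -/
def suM (γ : ℝ) (j : ℕ) : ℕ := ⌊γ * (j : ℝ)⌋₊ + 1

/-- `M̃(i) = max {l ∈ {1, …, n} | m(l) ≤ i}`. -/
def suMtilde (γ : ℝ) (n i : ℕ) : ℕ :=
  ((Finset.Icc 1 n).filter fun l => suM γ l ≤ i).sup id

/-- `g_i(l) = max {i - n + l, m(l)}`. Truncated subtraction is harmless since `m(l) ≥ 1`. -/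
def suG (γ : ℝ) (n i l : ℕ) : ℕ := max (i + l - n) (suM γ l)

/-- `M(i) = g_i(M̃(i))`. -/
def suTop (γ : ℝ) (n i : ℕ) : ℕ := suG γ n i (suMtilde γ n i)

/-- `t_k(i) = max g_i⁻¹({k})`, with `g_i` defined on `{1, …, M̃(i)}`. -/
def suT (γ : ℝ) (n i k : ℕ) : ℕ :=
  ((Finset.Icc 1 (suMtilde γ n i)).filter fun l => suG γ n i l = k).sup id

/-- The `γ`-FDP step-up matrix. The indices `t_1(i), …, t_{M(i)}(i)` are distinct, so at most one
summand is non-zero: the entry is `i (1/k - 1/(k+1))` at `j = t_k(i)` for `k < M(i)`, `i / M(i)` at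
`j = t_{M(i)}(i)`, and `0` for all other `j`. -/
def fdpMatrixSU (n : ℕ) (γ : ℝ) : Matrix (Fin n) (Fin n) ℝ :=
  Matrix.of fun i j =>
    (((i : ℕ) + 1 : ℕ) : ℝ) *
      ∑ k ∈ Finset.Icc 1 (suTop γ n (i + 1)),
        if (j : ℕ) + 1 = suT γ n (i + 1) k then stepWeight (suTop γ n (i + 1)) k else 0

/-- `k_i(l) = min {n, n + l - i, ⌈l/γ⌉ - 1}` for `i ≤ n`, where `l/γ = ∞` if `γ = 0`. -/
def sdK (γ : ℝ) (n i l : ℕ) : ℕ :=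
  if γ = 0 then min n (n + l - i)
  else min n (min (n + l - i) (⌈(l : ℝ) / γ⌉₊ - 1))

/-- `N(i) = min {⌊γ n⌋ + 1, i, ⌊γ ((n - i)/(1 - γ) + 1)⌋ + 1}`. -/
def sdN (γ : ℝ) (n i : ℕ) : ℕ :=
  min (⌊γ * (n : ℝ)⌋₊ + 1)
    (min i (⌊γ * (((n : ℝ) - (i : ℝ)) / (1 - γ) + 1)⌋₊ + 1))

/-- The entry `Ã_{il}` of the auxiliary matrix of the step-down case. -/
def sdAtilde (γ : ℝ) (n i l : ℕ) : ℝ := (i : ℝ) * stepWeight (sdN γ n i) l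

/-- The `γ`-FDP step-down matrix: `A_{ij} = ∑_{l ∈ k_i⁻¹({j})} Ã_{il}`, where `k_i` is defined on
`{1, …, ⌊γ n⌋ + 1}` (an empty sum is `0`). -/
def fdpMatrixSD (n : ℕ) (γ : ℝ) : Matrix (Fin n) (Fin n) ℝ :=
  Matrix.of fun i j =>
    ∑ l ∈ (Finset.Icc 1 (⌊γ * (n : ℝ)⌋₊ + 1)).filter
        (fun l => sdK γ n (i + 1) l = (j : ℕ) + 1),
      sdAtilde γ n (i + 1) l

/-- The matrix associated with the `γ`-FDP and the direction of stepping. -/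
def fdpMatrix (s : Stepping) (n : ℕ) (γ : ℝ) : Matrix (Fin n) (Fin n) ℝ :=
  match s with
  | .up => fdpMatrixSU n γ
  | .down => fdpMatrixSD n γ

/-! ### The linear program -/

/-- The constraints of the linear program: `A ξ ≤ 1`, `0 ≤ ξ_1 ≤ ⋯ ≤ ξ_n` and `ξ ≥ c`. -/
structure LPFeasible {n : ℕ} (A : Matrix (Fin n) (Fin n) ℝ) (c ξ : Fin n → ℝ) : Prop where
  mulVec_le : ∀ i, A.mulVec ξ i ≤ 1
  nonneg : ∀ i, 0 ≤ ξ i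
  mono : Monotone ξ
  ge : ∀ i, c i ≤ ξ i

/-- The objective function `F(ξ) = ∑_j a_j ξ_j` with `a_j = ∑_i A_{ij}`. -/
def lpObjective {n : ℕ} (A : Matrix (Fin n) (Fin n) ℝ) (ξ : Fin n → ℝ) : ℝ :=
  ∑ j, (∑ i, A i j) * ξ j

/-- `ξ` is a solution of the linear program, that is, a feasible point which maximises `F`. -/
structure IsModifiedProcedure {n : ℕ} (A : Matrix (Fin n) (Fin n) ℝ) (c ξ : Fin n → ℝ) :
    Prop where
  feasible : LPFeasible A c ξ
  optimal : ∀ η, LPFeasible A c η → lpObjective A η ≤ lpObjective A ξ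

end

end MultipleTesting

open MultipleTesting

/-!
The linear program has a solution because the entries of `A` are non-negative. A coordinate whose
column of `A` is not zero is bounded by the constraints, and the other coordinates do not occur in
the objective, so that cutting off all coordinates at a large constant loses nothing and the maximum
may be taken over a compact set. Every feasible `ξ` dominates `c`, and the rejected sets of both
procedures are increasing in the critical constants; this gives the claim on power.

The control of the FDP rests on one inequality, `measureReal_exists_card_le`: if `i` `p`-values are
stochastically larger than uniform, and `0 ≤ b₁ ≤ ⋯ ≤ b_N`, then the probability that for some `k`
at least `k` of them are `≤ b_k` is at most `i ∑ k, w_N(k) b_k`. Indeed, since the weights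
`w_N(k), …, w_N(N)` add up to `1 / k`, on this event the sum over the `i` `p`-values of
`∑ k, w_N(k) 1{p ≤ b_k}` is at least `1`, and Markov's inequality applies. The `i`-th rows of the
matrices are made such that `(A c)_i` is this bound for suitable thresholds `b_k = c_{t(k)}`.

Step-up: if `r` hypotheses are rejected and the FDP exceeds `γ`, then at least `m(r)` and at least
`i - n + r` true hypotheses have `p`-values `≤ c_r`, that is, at least `g_i(r)` of them. As `g_i` is
non-decreasing, starts at `1` and has steps at most `1`, each `k ≤ M(i)` is a value of `g_i`, and
`t_k(i)` is the largest `r` with `g_i(r) = k` (`exists_card_of_fdp_up`).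

Step-down: consider the first `r` such that among the `r` hypotheses with the smallest `p`-values
the proportion of true ones exceeds `γ`, and let `l` be the number of these true ones. Because
`l - 1 ≤ γ (r - 1)`, this `l` is at most `N(i)`, and `r ≤ k_i(l)`. Since the procedure
stops no earlier than at `r`, these `l` `p`-values are `≤ c_r ≤ c_{k_i(l)}`
(`exists_card_of_fdp_down`).
-/

namespace MultipleTesting

open MeasureTheory

/-! ### Weights -/

theorem stepWeight_nonneg (N k : ℕ) : 0 ≤ stepWeight N k := by
  unfold stepWeight
  split_ifs with h
  · have hk : (0 : ℝ) < k := by exact_mod_cast h.1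
    rw [sub_nonneg]
    exact one_div_le_one_div_of_le hk (by linarith)
  · positivity
  · exact le_rfl

theorem stepWeight_eq_zero {N k : ℕ} (h : N < k) : stepWeight N k = 0 := by
  unfold stepWeight
  rw [if_neg (by omega), if_neg (by omega)]

/-- The sum over the tail telescopes. -/
theorem sum_stepWeight_Icc {N k : ℕ} (hk : 1 ≤ k) (hkN : k ≤ N) :
    ∑ l ∈ Finset.Icc k N, stepWeight N l = 1 / (k : ℝ) := by
  induction hkN using Nat.decreasingInduction with
  | self => simp [stepWeight]
  | of_succ m hm ih =>
    have hmN : m < N := hm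
    rw [← Finset.insert_Icc_succ_left_eq_Icc hmN.le, Finset.sum_insert (by simp)]
    rw [Nat.succ_eq_succ, Nat.succ_eq_add_one, ih (by omega)]
    rw [stepWeight, if_pos ⟨hk, hmN⟩]
    push_cast
    ring

/-! ### The probability inequality -/

/-- The bound on the distribution function of a `p`-value of a true hypothesis extends from the
interval `(0, 1)` to all non-negative arguments. -/
theorem IsPValues.measureReal_le {n : ℕ} {Ω : Type u} [MeasurableSpace Ω] {P : Measure Ω}
    [IsProbabilityMeasure P] {I : Finset (Fin n)} {PV : Fin n → Ω → ℝ} (h : IsPValues P I PV)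
    {i : Fin n} (hi : i ∈ I) {x : ℝ} (hx : 0 ≤ x) : P.real {ω | PV i ω ≤ x} ≤ x := by
  refine le_of_forall_gt_imp_ge_of_dense fun y hy => ?_
  rcases lt_or_ge y 1 with hy1 | hy1
  · refine le_trans (measureReal_mono fun ω hω => ?_) (h.le_uniform i hi y (hx.trans_lt hy) hy1)
    exact le_trans (show PV i ω ≤ x from hω) hy.le
  · exact measureReal_le_one.trans hy1

/-- The inequality behind both procedures. No independence is needed, because Markov's inequality
is applied to a sum over the true hypotheses. -/
theorem measureReal_exists_card_le {n : ℕ} {Ω : Type u} [MeasurableSpace Ω] {P : Measure Ω}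
    [IsProbabilityMeasure P] {I : Finset (Fin n)} {PV : Fin n → Ω → ℝ} (h : IsPValues P I PV)
    (N : ℕ) (b : ℕ → ℝ) (hb0 : ∀ k, 0 ≤ b k)
    (hb : ∀ k l, 1 ≤ k → k ≤ l → l ≤ N → b k ≤ b l) :
    P.real {ω | ∃ k ∈ Finset.Icc 1 N, k ≤ (I.filter fun j => PV j ω ≤ b k).card} ≤
      (I.card : ℝ) * ∑ k ∈ Finset.Icc 1 N, stepWeight N k * b k := by
  have hmeas : ∀ j k, MeasurableSet {ω | PV j ω ≤ b k} := fun j k =>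
    measurableSet_le (h.measurable j) measurable_const
  set f : Fin n → Ω → ℝ := fun j ω => ∑ k ∈ Finset.Icc 1 N,
    {ω | PV j ω ≤ b k}.indicator (fun _ => stepWeight N k) ω with hf
  have hf0 : ∀ j ω, 0 ≤ f j ω := fun j ω => Finset.sum_nonneg fun k _ =>
    Set.indicator_nonneg (fun _ _ => stepWeight_nonneg N k) ω
  have hint : ∀ j k, Integrable ({ω | PV j ω ≤ b k}.indicator fun _ => stepWeight N k) P :=
    fun j k => (integrable_const _).indicator (hmeas j k)
  have hfint : ∀ j, Integrable (f j) P := fun j => integrable_finsetSum _ fun k _ => hint j k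
  -- A `p`-value below `b k` is also below `b l` for `l ≥ k`, so it contributes at least `1 / k`.
  have hlow : ∀ j ω, ∀ k ∈ Finset.Icc 1 N, PV j ω ≤ b k → 1 / (k : ℝ) ≤ f j ω := by
    intro j ω k hk hle
    obtain ⟨hk1, hkN⟩ := Finset.mem_Icc.1 hk
    rw [← sum_stepWeight_Icc hk1 hkN]
    calc ∑ l ∈ Finset.Icc k N, stepWeight N l
        = ∑ l ∈ Finset.Icc k N, {ω | PV j ω ≤ b l}.indicator (fun _ => stepWeight N l) ω := by
          refine Finset.sum_congr rfl fun l hl => ?_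
          obtain ⟨hl1, hl2⟩ := Finset.mem_Icc.1 hl
          rw [Set.indicator_of_mem]
          exact hle.trans (hb k l hk1 hl1 hl2)
      _ ≤ f j ω := Finset.sum_le_sum_of_subset_of_nonneg (Finset.Icc_subset_Icc_left hk1)
          fun l _ _ => Set.indicator_nonneg (fun _ _ => stepWeight_nonneg N l) ω
  have hsub : {ω | ∃ k ∈ Finset.Icc 1 N, k ≤ (I.filter fun j => PV j ω ≤ b k).card} ⊆
      {ω | 1 ≤ ∑ j ∈ I, f j ω} := by
    rintro ω ⟨k, hk, hcard⟩
    have hk0 : (0 : ℝ) < k := by exact_mod_cast (Finset.mem_Icc.1 hk).1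
    calc (1 : ℝ) = (k : ℝ) * (1 / (k : ℝ)) := by field_simp
      _ ≤ ((I.filter fun j => PV j ω ≤ b k).card : ℝ) * (1 / (k : ℝ)) := by gcongr
      _ = ∑ j ∈ I.filter fun j => PV j ω ≤ b k, 1 / (k : ℝ) := by
          rw [Finset.sum_const, nsmul_eq_mul]
      _ ≤ ∑ j ∈ I.filter fun j => PV j ω ≤ b k, f j ω :=
          Finset.sum_le_sum fun j hj => hlow j ω k hk (Finset.mem_filter.1 hj).2
      _ ≤ ∑ j ∈ I, f j ω :=
          Finset.sum_le_sum_of_subset_of_nonneg (Finset.filter_subset _ _) fun j _ _ => hf0 j ω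
  have hmarkov := mul_meas_ge_le_integral_of_nonneg (μ := P) (f := fun ω => ∑ j ∈ I, f j ω)
    (Filter.Eventually.of_forall fun ω => Finset.sum_nonneg fun j _ => hf0 j ω)
    (integrable_finsetSum _ fun j _ => hfint j) 1
  rw [one_mul] at hmarkov
  refine (measureReal_mono hsub).trans (hmarkov.trans ?_)
  rw [integral_finsetSum _ fun j _ => hfint j, ← nsmul_eq_mul]
  refine Finset.sum_le_card_nsmul _ _ _ fun j hj => ?_
  rw [hf, integral_finsetSum _ fun k _ => hint j k]
  refine Finset.sum_le_sum fun k _ => ?_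
  rw [integral_indicator_const _ (hmeas j k), smul_eq_mul, mul_comm]
  exact mul_le_mul_of_nonneg_left (h.measureReal_le hj (hb0 k)) (stepWeight_nonneg N k)

/-! ### Rejected hypotheses -/

/-- The hypotheses with the `r` smallest `p`-values, ties being broken by `Tuple.sort`. -/
noncomputable def smallest {n : ℕ} (p : Fin n → ℝ) (r : ℕ) : Finset (Fin n) :=
  (Finset.univ.filter fun i : Fin n => (i : ℕ) < r).image (Tuple.sort p)

section

variable {n : ℕ} {p : Fin n → ℝ}

theorem card_smallest {r : ℕ} (hr : r ≤ n) : (smallest p r).card = r := by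
  rw [smallest, Finset.card_image_of_injective _ (Tuple.sort p).injective,
    Fin.card_filter_val_lt, min_eq_right hr]

theorem smallest_mono {r t : ℕ} (h : r ≤ t) : smallest p r ⊆ smallest p t :=
  Finset.image_subset_image fun i hi => by
    simp only [Finset.mem_filter, Finset.mem_univ, true_and] at hi ⊢
    omega

theorem le_of_mem_smallest {i j : Fin n} (h : j ∈ smallest p (i + 1)) :
    p j ≤ p (Tuple.sort p i) := by
  obtain ⟨k, hk, rfl⟩ := Finset.mem_image.1 h
  simp only [Finset.mem_filter, Finset.mem_univ, true_and] at hk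
  exact Tuple.monotone_sort p (Fin.le_def.2 (by omega))

/-- At most `n - |I|` of the `r` smallest `p`-values belong to false hypotheses. -/
theorem add_card_le_card_smallest_inter (I : Finset (Fin n)) {r : ℕ} (hr : r ≤ n) :
    r + I.card ≤ n + (smallest p r ∩ I).card := by
  have h := Finset.card_union_add_card_inter (smallest p r) I
  rw [card_smallest hr] at h
  have := Finset.card_le_univ (smallest p r ∪ I)
  rw [Fintype.card_fin] at this
  omega

theorem card_smallest_inter_le (I : Finset (Fin n)) {i : Fin n} {x : ℝ}
    (h : p (Tuple.sort p i) ≤ x) :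
    (smallest p (i + 1) ∩ I).card ≤ (I.filter fun j => p j ≤ x).card :=
  Finset.card_le_card fun _ hj => Finset.mem_filter.2
    ⟨(Finset.mem_inter.1 hj).2, (le_of_mem_smallest (Finset.mem_inter.1 hj).1).trans h⟩

theorem numRejections_le (s : Stepping) (c p : Fin n → ℝ) : numRejections s c p ≤ n := by
  cases s <;> exact Finset.sup_le fun i _ => i.2

theorem exists_of_numRejections_up_pos {c : Fin n → ℝ} (h : 0 < numRejections .up c p) :
    ∃ i : Fin n, numRejections .up c p = i + 1 ∧ p (Tuple.sort p i) ≤ c i := by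
  simp only [numRejections] at h ⊢
  have hne : (Finset.univ.filter fun i : Fin n => p (Tuple.sort p i) ≤ c i).Nonempty := by
    by_contra hne
    rw [Finset.not_nonempty_iff_eq_empty.1 hne] at h
    simp at h
  obtain ⟨i, hi, he⟩ := Finset.exists_mem_eq_sup _ hne fun i : Fin n => (i : ℕ) + 1
  exact ⟨i, he, (Finset.mem_filter.1 hi).2⟩

theorem le_of_lt_numRejections_down {c : Fin n → ℝ} {j : Fin n}
    (h : (j : ℕ) < numRejections .down c p) : p (Tuple.sort p j) ≤ c j := by
  simp only [numRejections, Finset.lt_sup_iff] at h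
  obtain ⟨i, hi, hji⟩ := h
  exact (Finset.mem_filter.1 hi).2 j (Fin.le_def.2 (by omega))

theorem numRejections_mono (s : Stepping) {c d : Fin n → ℝ} (h : ∀ i, c i ≤ d i)
    (p : Fin n → ℝ) : numRejections s c p ≤ numRejections s d p := by
  cases s
  · refine Finset.sup_mono fun i hi => ?_
    simp only [Finset.mem_filter, Finset.mem_univ, true_and] at hi ⊢
    exact hi.trans (h i)
  · refine Finset.sup_mono fun i hi => ?_
    simp only [Finset.mem_filter, Finset.mem_univ, true_and] at hi ⊢
    exact fun j hj => (hi j hj).trans (h j)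

theorem rejected_eq_smallest (s : Stepping) (c p : Fin n → ℝ) :
    rejected s c p = smallest p (numRejections s c p) := rfl

theorem rejected_mono (s : Stepping) {c d : Fin n → ℝ} (h : ∀ i, c i ≤ d i) (p : Fin n → ℝ) :
    rejected s c p ⊆ rejected s d p :=
  smallest_mono (numRejections_mono s h p)

theorem atLeastAsPowerful_of_le (s : Stepping) {c d : Fin n → ℝ} (h : ∀ i, c i ≤ d i) :
    AtLeastAsPowerful.{u} s d c := by
  refine ⟨rejected_mono s h, fun I Ω _ P _ PV _ => lintegral_mono fun ω => ?_⟩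
  refine ENNReal.div_le_div_right (Nat.cast_le.2 (Finset.card_le_card ?_)) _
  exact Finset.sdiff_subset_sdiff (rejected_mono s h _) le_rfl

theorem lt_card_of_lt_fdp {s : Stepping} {c : Fin n → ℝ} {I : Finset (Fin n)} {γ : ℝ}
    (hγ : 0 ≤ γ) (h : γ < fdp s c p I) :
    0 < numRejections s c p ∧
      γ * (numRejections s c p : ℝ) < ((smallest p (numRejections s c p) ∩ I).card : ℝ) := by
  rw [fdp, rejected_eq_smallest, card_smallest (numRejections_le s c p)] at h
  have hpos : 0 < numRejections s c p := by
    by_contra h0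
    rw [Nat.eq_zero_of_not_pos h0, Nat.cast_zero, div_zero] at h
    exact absurd h hγ.not_gt
  exact ⟨hpos, (lt_div_iff₀ (by exact_mod_cast hpos)).1 h⟩

end

/-! ### Vectors with one-based indices -/

/-- The `r`-th critical constant for `r ∈ {1, …, n}`; the value for other `r` is `0`. -/
noncomputable def constantAt {n : ℕ} (c : Fin n → ℝ) (r : ℕ) : ℝ :=
  ∑ j : Fin n, if (j : ℕ) + 1 = r then c j else 0

section

variable {n : ℕ} {c : Fin n → ℝ}

theorem constantAt_succ (c : Fin n → ℝ) (j : Fin n) : constantAt c (j + 1) = c j := by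
  rw [constantAt, Finset.sum_eq_single j]
  · simp
  · intro i _ hij
    rw [if_neg]
    intro h
    exact hij (Fin.ext (by omega))
  · simp

theorem constantAt_nonneg (hc : c ∈ criticalConstants n) (r : ℕ) : 0 ≤ constantAt c r :=
  Finset.sum_nonneg fun j _ => by
    split_ifs
    · exact hc.1 j
    · exact le_rfl

theorem constantAt_le (hc : c ∈ criticalConstants n) {r t : ℕ} (hrt : r ≤ t) (ht : t ≤ n) :
    constantAt c r ≤ constantAt c t := by
  rcases Nat.eq_zero_or_pos r with rfl | hr
  · simpa [constantAt] using constantAt_nonneg hc t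
  · obtain ⟨r, rfl⟩ : ∃ q, r = q + 1 := ⟨r - 1, by omega⟩
    obtain ⟨t, rfl⟩ : ∃ q, t = q + 1 := ⟨t - 1, by omega⟩
    rw [constantAt_succ c ⟨r, by omega⟩, constantAt_succ c ⟨t, by omega⟩]
    exact hc.2 (Fin.mk_le_mk.2 (by omega))

theorem fdpMatrixSU_mulVec (γ : ℝ) (c : Fin n → ℝ) (i : Fin n) :
    (fdpMatrixSU n γ).mulVec c i = ((i + 1 : ℕ) : ℝ) *
      ∑ k ∈ Finset.Icc 1 (suTop γ n (i + 1)),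
        stepWeight (suTop γ n (i + 1)) k * constantAt c (suT γ n (i + 1) k) := by
  simp only [Matrix.mulVec, dotProduct, fdpMatrixSU, Matrix.of_apply, constantAt, mul_assoc]
  rw [← Finset.mul_sum]
  simp only [Finset.sum_mul, Finset.mul_sum]
  rw [Finset.sum_comm]
  simp only [ite_mul, mul_ite, zero_mul, mul_zero]

theorem fdpMatrixSD_mulVec (γ : ℝ) (c : Fin n → ℝ) (i : Fin n) :
    (fdpMatrixSD n γ).mulVec c i = ((i + 1 : ℕ) : ℝ) *
      ∑ l ∈ Finset.Icc 1 (⌊γ * (n : ℝ)⌋₊ + 1),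
        stepWeight (sdN γ n (i + 1)) l * constantAt c (sdK γ n (i + 1) l) := by
  simp only [Matrix.mulVec, dotProduct, fdpMatrixSD, Matrix.of_apply, constantAt, sdAtilde,
    Finset.sum_filter]
  simp only [Finset.sum_mul, Finset.mul_sum]
  rw [Finset.sum_comm]
  refine Finset.sum_congr rfl fun l _ => Finset.sum_congr rfl fun j _ => ?_
  simp only [eq_comm (a := sdK γ n (i + 1) l), ite_mul, mul_ite, zero_mul, mul_zero, mul_assoc]

theorem fdpMatrix_nonneg (s : Stepping) (n : ℕ) (γ : ℝ) (i j : Fin n) :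
    0 ≤ fdpMatrix s n γ i j := by
  cases s
  · refine mul_nonneg (Nat.cast_nonneg _) (Finset.sum_nonneg fun k _ => ?_)
    split_ifs
    · exact stepWeight_nonneg _ _
    · exact le_rfl
  · rw [fdpMatrix, fdpMatrixSD, Matrix.of_apply]
    exact Finset.sum_nonneg fun l _ => mul_nonneg (Nat.cast_nonneg _) (stepWeight_nonneg _ _)

end

/-! ### The step-up procedure -/

section

variable {γ : ℝ} {n i : ℕ}

theorem suM_mono (hγ : 0 ≤ γ) : Monotone (suM γ) := fun a b hab => by
  unfold suM
  gcongr

theorem suM_succ_le (hγ₀ : 0 ≤ γ) (hγ₁ : γ < 1) (l : ℕ) : suM γ (l + 1) ≤ suM γ l + 1 := by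
  unfold suM
  have h : γ * ((l + 1 : ℕ) : ℝ) ≤ γ * l + (1 : ℕ) := by
    push_cast
    linarith
  have := Nat.floor_le_floor h
  rw [Nat.floor_add_natCast (by positivity)] at this
  omega

theorem suM_one (hγ₁ : γ < 1) : suM γ 1 = 1 := by
  simp [suM, Nat.floor_eq_zero, hγ₁]

theorem suG_mono (hγ : 0 ≤ γ) : Monotone (suG γ n i) := fun a b hab => by
  have := suM_mono hγ hab
  unfold suG
  omega

theorem suG_pos (l : ℕ) : 1 ≤ suG γ n i l := by
  have : 1 ≤ suM γ l := by simp [suM]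
  unfold suG
  omega

theorem le_suMtilde {l : ℕ} (hl : 1 ≤ l) (hln : l ≤ n) (h : suM γ l ≤ i) :
    l ≤ suMtilde γ n i :=
  Finset.le_sup (f := id) (Finset.mem_filter.2 ⟨Finset.mem_Icc.2 ⟨hl, hln⟩, h⟩)

theorem suMtilde_le : suMtilde γ n i ≤ n :=
  Finset.sup_le fun _ hl => (Finset.mem_Icc.1 (Finset.mem_filter.1 hl).1).2

/-- `g_i` starts at `1` and has steps at most `1`, hence omits no value. -/
theorem exists_suG_eq (hγ₀ : 0 ≤ γ) (hγ₁ : γ < 1) (hi : i ≤ n) {L : ℕ} (hL : 1 ≤ L) {k : ℕ}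
    (hk : 1 ≤ k) (hkL : k ≤ suG γ n i L) : ∃ l ∈ Finset.Icc 1 L, suG γ n i l = k := by
  induction L, hL using Nat.le_induction with
  | base =>
    refine ⟨1, by simp, ?_⟩
    have := suM_one hγ₁
    unfold suG at hkL ⊢
    omega
  | succ L hL ih =>
    by_cases h : k ≤ suG γ n i L
    · obtain ⟨l, hl, he⟩ := ih h
      exact ⟨l, Finset.Icc_subset_Icc_right (Nat.le_succ L) hl, he⟩
    · refine ⟨L + 1, by simp, ?_⟩
      have := suM_succ_le hγ₀ hγ₁ L
      unfold suG at h hkL ⊢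
      omega

theorem suT_spec (hγ₀ : 0 ≤ γ) (hγ₁ : γ < 1) (hi₁ : 1 ≤ i) (hi : i ≤ n) {k : ℕ}
    (hk : k ∈ Finset.Icc 1 (suTop γ n i)) : suT γ n i k ≤ n ∧ suG γ n i (suT γ n i k) = k := by
  obtain ⟨hk1, hk2⟩ := Finset.mem_Icc.1 hk
  have hL : 1 ≤ suMtilde γ n i := le_suMtilde le_rfl (hi₁.trans hi) ((suM_one hγ₁).trans_le hi₁)
  obtain ⟨l, hl, he⟩ := exists_suG_eq hγ₀ hγ₁ hi hL hk1 hk2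
  obtain ⟨t, ht, heq⟩ := Finset.exists_mem_eq_sup
    ((Finset.Icc 1 (suMtilde γ n i)).filter fun l => suG γ n i l = k)
    ⟨l, Finset.mem_filter.2 ⟨hl, he⟩⟩ id
  rw [Finset.mem_filter, Finset.mem_Icc] at ht
  rw [suT, heq]
  exact ⟨ht.1.2.trans suMtilde_le, ht.2⟩

theorem suT_mono (hγ₀ : 0 ≤ γ) (hγ₁ : γ < 1) (hi₁ : 1 ≤ i) (hi : i ≤ n) {k l : ℕ}
    (hk : 1 ≤ k) (hkl : k ≤ l) (hl : l ≤ suTop γ n i) : suT γ n i k ≤ suT γ n i l := by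
  by_contra! h
  have h1 := (suT_spec hγ₀ hγ₁ hi₁ hi (Finset.mem_Icc.2 ⟨hk, hkl.trans hl⟩)).2
  have h2 := (suT_spec hγ₀ hγ₁ hi₁ hi (Finset.mem_Icc.2 ⟨hk.trans hkl, hl⟩)).2
  have h3 := suG_mono (n := n) (i := i) hγ₀ h.le
  rw [h1, h2] at h3
  rw [le_antisymm hkl h3] at h
  exact lt_irrefl _ h

/-- A step-up procedure whose FDP exceeds `γ` has, for some `k ≤ M(i)`, at least `k` `p`-values of
true hypotheses below the constant with index `t_k(i)`. -/
theorem exists_card_of_fdp_up (hγ₀ : 0 ≤ γ) (hγ₁ : γ < 1) {c p : Fin n → ℝ}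
    (hc : c ∈ criticalConstants n) {I : Finset (Fin n)} (hI : I.Nonempty)
    (h : γ < fdp .up c p I) :
    ∃ k ∈ Finset.Icc 1 (suTop γ n I.card),
      k ≤ (I.filter fun j => p j ≤ constantAt c (suT γ n I.card k)).card := by
  obtain ⟨hpos, hlt⟩ := lt_card_of_lt_fdp hγ₀ h
  obtain ⟨q, hq, hpq⟩ := exists_of_numRejections_up_pos hpos
  rw [hq] at hlt
  have hcard := card_smallest_inter_le I hpq
  have hle := add_card_le_card_smallest_inter (p := p) I (r := q + 1) q.2
  have hm : suM γ (q + 1) ≤ (smallest p (q + 1) ∩ I).card :=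
    (Nat.floor_lt (by positivity)).2 hlt
  have hmI := hm.trans (Finset.card_le_card Finset.inter_subset_right)
  have hr : (q : ℕ) + 1 ≤ suMtilde γ n I.card := le_suMtilde (by omega) q.2 hmI
  have hk : suG γ n I.card (q + 1) ∈ Finset.Icc 1 (suTop γ n I.card) :=
    Finset.mem_Icc.2 ⟨suG_pos _, suG_mono hγ₀ hr⟩
  have hI1 : 1 ≤ I.card := hI.card_pos
  have hIn : I.card ≤ n := by simpa using Finset.card_le_univ I
  have ht : (q : ℕ) + 1 ≤ suT γ n I.card (suG γ n I.card (q + 1)) :=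
    Finset.le_sup (f := id)
      (Finset.mem_filter.2 ⟨Finset.mem_Icc.2 ⟨by omega, hr⟩, rfl⟩)
  refine ⟨_, hk, ?_⟩
  calc suG γ n I.card (q + 1) ≤ (smallest p (q + 1) ∩ I).card := by
        unfold suG
        omega
    _ ≤ _ := card_smallest_inter_le I <| hpq.trans <| (constantAt_succ c q).symm.trans_le <|
        constantAt_le hc ht (suT_spec hγ₀ hγ₁ hI1 hIn hk).1

end

/-! ### The step-down procedure -/

section

variable {γ : ℝ} {n i : ℕ}

theorem sdK_le (l : ℕ) : sdK γ n i l ≤ n := by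
  unfold sdK
  split_ifs <;> exact min_le_left _ _

theorem sdK_mono (hγ : 0 ≤ γ) : Monotone (sdK γ n i) := fun a b hab => by
  unfold sdK
  split_ifs
  · omega
  · have : ⌈(a : ℝ) / γ⌉₊ ≤ ⌈(b : ℝ) / γ⌉₊ := by gcongr
    omega

/-- `k_i(l)` is the largest possible number of rejections if `l` out of `i` true hypotheses are
rejected and the FDP exceeds `γ`. -/
theorem le_sdK (hγ : 0 ≤ γ) {r l : ℕ} (hrn : r ≤ n) (hri : r + i ≤ n + l)
    (h : γ * (r : ℝ) < l) : r ≤ sdK γ n i l := by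
  unfold sdK
  split_ifs with h0
  · omega
  · have hγ' : 0 < γ := lt_of_le_of_ne hγ (Ne.symm h0)
    have : r < ⌈(l : ℝ) / γ⌉₊ := by
      rw [Nat.lt_ceil, lt_div_iff₀ hγ', mul_comm]
      exact h
    omega

/-- The bound `N(i)` on the number of rejected true hypotheses at the first step at which the FDP
exceeds `γ`; before this step there are `r` rejections, `l` of which are true hypotheses. -/
theorem succ_le_sdN (hγ₀ : 0 ≤ γ) (hγ₁ : γ < 1) {r l : ℕ} (hin : i ≤ n) (hrn : r ≤ n)
    (hri : r + i ≤ n + l) (hli : l + 1 ≤ i) (h : (l : ℝ) ≤ γ * r) : l + 1 ≤ sdN γ n i := by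
  have h1 : (0 : ℝ) < 1 - γ := by linarith
  have hin' : (i : ℝ) ≤ n := by exact_mod_cast hin
  have hrn' : (r : ℝ) ≤ n := by exact_mod_cast hrn
  have hri' : (r : ℝ) + i ≤ n + l := by exact_mod_cast hri
  refine le_min ?_ (le_min hli ?_)
  · refine Nat.succ_le_succ (Nat.le_floor (h.trans ?_))
    gcongr
  · refine Nat.succ_le_succ (Nat.le_floor ?_)
    have h2 : (l : ℝ) * (1 - γ) ≤ γ * (n - i) := by nlinarith
    calc (l : ℝ) ≤ γ * (n - i) / (1 - γ) := (le_div_iff₀ h1).2 h2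
      _ = γ * ((n - i) / (1 - γ)) := by ring
      _ ≤ γ * ((n - i) / (1 - γ) + 1) := by gcongr; linarith

/-- A step-down procedure whose FDP exceeds `γ` has, for some `l ≤ N(i)`, at least `l` `p`-values
of true hypotheses below the constant with index `k_i(l)`. -/
theorem exists_card_of_fdp_down (hγ₀ : 0 ≤ γ) (hγ₁ : γ < 1) {c p : Fin n → ℝ}
    (hc : c ∈ criticalConstants n) {I : Finset (Fin n)} (h : γ < fdp .down c p I) :
    ∃ l ∈ Finset.Icc 1 (sdN γ n I.card),
      l ≤ (I.filter fun j => p j ≤ constantAt c (sdK γ n I.card l)).card := by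
  obtain ⟨-, hlt⟩ := lt_card_of_lt_fdp hγ₀ h
  -- the first step at which the proportion of true hypotheses exceeds `γ`
  have hex : ∃ r : ℕ, γ * (r : ℝ) < ((smallest p r ∩ I).card : ℝ) := ⟨_, hlt⟩
  classical
  obtain ⟨r, hr⟩ : ∃ r, r = Nat.find hex := ⟨_, rfl⟩
  have hspec : γ * (r : ℝ) < ((smallest p r ∩ I).card : ℝ) := hr ▸ Nat.find_spec hex
  have hrR : r ≤ numRejections .down c p := hr ▸ Nat.find_min' hex hlt
  have hRn := numRejections_le .down c p
  rcases r with _ | q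
  · simp [smallest] at hspec
  have hmin : ((smallest p q ∩ I).card : ℝ) ≤ γ * (q : ℝ) :=
    not_lt.1 (Nat.find_min hex (hr ▸ Nat.lt_succ_self q))
  have hqn : q < n := by omega
  set v := (smallest p q ∩ I).card with hv
  have hw : v < (smallest p (q + 1) ∩ I).card := by
    have : (v : ℝ) < ((smallest p (q + 1) ∩ I).card : ℝ) := by
      refine (hmin.trans ?_).trans_lt hspec
      gcongr
      exact Nat.le_succ q
    exact_mod_cast this
  have hw' : (smallest p (q + 1) ∩ I).card ≤ v + 1 := by
    have hd : smallest p (q + 1) ∩ I ⊆ (smallest p q ∩ I) ∪ (smallest p (q + 1) \ smallest p q) :=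
      fun x hx => by
        simp only [Finset.mem_union, Finset.mem_inter, Finset.mem_sdiff] at hx ⊢
        tauto
    refine (Finset.card_le_card hd).trans ((Finset.card_union_le _ _).trans ?_)
    rw [Finset.card_sdiff_of_subset (smallest_mono (Nat.le_succ q)), card_smallest hqn,
      card_smallest hqn.le]
    omega
  have heq : (smallest p (q + 1) ∩ I).card = v + 1 := by omega
  have hIn : I.card ≤ n := by simpa using Finset.card_le_univ I
  have hvI : v + 1 ≤ I.card := heq ▸ Finset.card_le_card Finset.inter_subset_right
  refine ⟨v + 1, Finset.mem_Icc.2 ⟨by omega, succ_le_sdN hγ₀ hγ₁ hIn hqn.le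
    (add_card_le_card_smallest_inter I hqn.le) hvI hmin⟩, ?_⟩
  have hK : q + 1 ≤ sdK γ n I.card (v + 1) := le_sdK hγ₀ hqn
    (heq ▸ add_card_le_card_smallest_inter I hqn) (heq ▸ hspec)
  refine heq.symm.le.trans (card_smallest_inter_le (i := ⟨q, hqn⟩) I ?_)
  refine (le_of_lt_numRejections_down (c := c) (by simpa using hrR)).trans ?_
  exact (constantAt_succ c ⟨q, hqn⟩).symm.trans_le (constantAt_le hc hK (sdK_le _))

end

/-! ### Control of the false discovery proportion -/

theorem mem_fdpControlling_of_mulVec_le {s : Stepping} {n : ℕ} {γ α : ℝ} (hγ₀ : 0 ≤ γ)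
    (hγ₁ : γ < 1) {c : Fin n → ℝ} (hc : c ∈ criticalConstants n)
    (h : ∀ i, (fdpMatrix s n γ).mulVec c i ≤ α) : c ∈ fdpControlling.{u} s n α γ := by
  refine ⟨hc, fun I hI Ω _ P _ PV hPV => ?_⟩
  have hI1 : 1 ≤ I.card := hI.card_pos
  have hIn : I.card ≤ n := by simpa using Finset.card_le_univ I
  have hi := h ⟨I.card - 1, by omega⟩
  have hsucc : I.card - 1 + 1 = I.card := by omega
  cases s
  · simp only [fdpMatrix, fdpMatrixSU_mulVec, hsucc] at hi
    refine le_trans (measureReal_mono fun ω hω => ?_) (le_trans (measureReal_exists_card_le hPV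
      (suTop γ n I.card) (fun k => constantAt c (suT γ n I.card k))
      (fun k => constantAt_nonneg hc _) fun k l hk hkl hl => ?_) hi)
    · exact exists_card_of_fdp_up hγ₀ hγ₁ hc hI hω
    · exact constantAt_le hc (suT_mono hγ₀ hγ₁ hI1 hIn hk hkl hl)
        (suT_spec hγ₀ hγ₁ hI1 hIn (Finset.mem_Icc.2 ⟨hk.trans hkl, hl⟩)).1
  · simp only [fdpMatrix, fdpMatrixSD_mulVec, hsucc] at hi
    have hN : Finset.Icc 1 (sdN γ n I.card) ⊆ Finset.Icc 1 (⌊γ * (n : ℝ)⌋₊ + 1) :=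
      Finset.Icc_subset_Icc_right (min_le_left _ _)
    rw [← Finset.sum_subset hN fun l hl hlN => by
      rw [stepWeight_eq_zero, zero_mul]
      rw [Finset.mem_Icc] at hl hlN
      omega] at hi
    refine le_trans (measureReal_mono fun ω hω => ?_) (le_trans (measureReal_exists_card_le hPV
      (sdN γ n I.card) (fun l => constantAt c (sdK γ n I.card l))
      (fun l => constantAt_nonneg hc _) fun k l _ hkl _ => ?_) hi)
    · exact exists_card_of_fdp_down hγ₀ hγ₁ hc hω
    · exact constantAt_le hc (sdK_mono hγ₀ hkl) (sdK_le _)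

/-! ### The linear program -/

section

variable {n : ℕ} {A : Matrix (Fin n) (Fin n) ℝ} {c ξ : Fin n → ℝ}

theorem mul_le_mulVec (hA : ∀ i j, 0 ≤ A i j) (hξ : ∀ i, 0 ≤ ξ i) (i j : Fin n) :
    A i j * ξ j ≤ A.mulVec ξ i :=
  Finset.single_le_sum (f := fun j => A i j * ξ j) (fun j _ => mul_nonneg (hA i j) (hξ j))
    (Finset.mem_univ j)

theorem mulVec_nonneg (hA : ∀ i j, 0 ≤ A i j) (hξ : ∀ i, 0 ≤ ξ i) (i : Fin n) :
    0 ≤ A.mulVec ξ i := by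
  rw [Matrix.mulVec, dotProduct]
  exact Finset.sum_nonneg fun j _ => mul_nonneg (hA i j) (hξ j)

theorem LPFeasible.mem_feasibleConstants (hA : ∀ i j, 0 ≤ A i j) (h : LPFeasible A c ξ) :
    ξ ∈ feasibleConstants A := by
  refine ⟨⟨h.nonneg, h.mono⟩, (pi_norm_le_iff_of_nonneg zero_le_one).2 fun i => ?_⟩
  rw [Real.norm_of_nonneg (mulVec_nonneg hA h.nonneg i)]
  exact h.mulVec_le i

theorem lpFeasible_self (hc : c ∈ feasibleConstants A) : LPFeasible A c c :=
  ⟨fun i => (le_abs_self _).trans ((norm_le_pi_norm _ i).trans hc.2), hc.1.1, hc.1.2,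
    fun _ => le_rfl⟩

theorem isClosed_setOf_lpFeasible (A : Matrix (Fin n) (Fin n) ℝ) (c : Fin n → ℝ) :
    IsClosed {ξ | LPFeasible A c ξ} := by
  have : {ξ | LPFeasible A c ξ} = (⋂ i, {ξ | A.mulVec ξ i ≤ 1}) ∩ ((⋂ i, {ξ | 0 ≤ ξ i}) ∩
      ({ξ | Monotone ξ} ∩ ⋂ i, {ξ | c i ≤ ξ i})) := by
    ext ξ
    simp only [Set.mem_inter_iff, Set.mem_iInter, Set.mem_ofPred_eq]
    exact ⟨fun h => ⟨h.1, h.2, h.3, h.4⟩, fun h => ⟨h.1, h.2.1, h.2.2.1, h.2.2.2⟩⟩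
  rw [this]
  refine (isClosed_iInter fun i => isClosed_le ?_ continuous_const).inter
    ((isClosed_iInter fun i => isClosed_le continuous_const (continuous_apply i)).inter
    (isClosed_monotone.inter
    (isClosed_iInter fun i => isClosed_le continuous_const (continuous_apply i))))
  simp only [Matrix.mulVec, dotProduct]
  fun_prop

/-- The feasible set need not be bounded, as columns of `A` may vanish. -/
theorem exists_isModifiedProcedure (hA : ∀ i j, 0 ≤ A i j) (hc : c ∈ feasibleConstants A) :
    ∃ ξ, IsModifiedProcedure A c ξ := by
  -- `K` bounds `c` and, in the feasible set, every coordinate with a non-zero column.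
  set K : ℝ := ∑ j, c j + ∑ i, ∑ j, (A i j)⁻¹ with hK
  have hinv : ∀ i j, 0 ≤ (A i j)⁻¹ := fun i j => inv_nonneg.2 (hA i j)
  have hcK : ∀ j, c j ≤ K := fun j =>
    (Finset.single_le_sum (fun j _ => hc.1.1 j) (Finset.mem_univ j)).trans
      (le_add_of_nonneg_right (Finset.sum_nonneg fun i _ => Finset.sum_nonneg fun j _ => hinv i j))
  have hAK : ∀ i j, (A i j)⁻¹ ≤ K := fun i j =>
    ((Finset.single_le_sum (f := fun j => (A i j)⁻¹) (fun j _ => hinv i j)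
      (Finset.mem_univ j)).trans
      (Finset.single_le_sum (f := fun i => ∑ j, (A i j)⁻¹)
        (fun i _ => Finset.sum_nonneg fun j _ => hinv i j) (Finset.mem_univ i))).trans
      (le_add_of_nonneg_left (Finset.sum_nonneg fun j _ => hc.1.1 j))
  have hcut : ∀ η, LPFeasible A c η → ∀ i j, A i j * min (η j) K = A i j * η j := by
    intro η hη i j
    rcases (hA i j).eq_or_lt with h0 | hpos
    · rw [← h0, zero_mul, zero_mul]
    · have h1 := (mul_le_mulVec hA hη.nonneg i j).trans (hη.mulVec_le i)
      have h2 : η j ≤ (A i j)⁻¹ := by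
        rw [← one_div, le_div_iff₀ hpos, mul_comm]
        exact h1
      rw [min_eq_left (h2.trans (hAK i j))]
  have hcutF : ∀ η, LPFeasible A c η → LPFeasible A c fun j => min (η j) K := fun η hη =>
    { mulVec_le := fun i => by
        refine le_trans (le_of_eq ?_) (hη.mulVec_le i)
        rw [Matrix.mulVec, Matrix.mulVec, dotProduct, dotProduct]
        exact Finset.sum_congr rfl fun j _ => hcut η hη i j
      nonneg := fun j => le_min (hη.nonneg j) ((hc.1.1 j).trans (hcK j))
      mono := fun a b hab => min_le_min_right K (hη.mono hab)
      ge := fun j => le_min (hη.ge j) (hcK j) }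
  have hcutO : ∀ η, LPFeasible A c η → lpObjective A (fun j => min (η j) K) = lpObjective A η :=
    fun η hη => by
      simp only [lpObjective, Finset.sum_mul]
      exact Finset.sum_congr rfl fun j _ => Finset.sum_congr rfl fun i _ => hcut η hη i j
  have hcomp : IsCompact ({ξ | LPFeasible A c ξ} ∩ Set.Icc 0 fun _ => K) :=
    isCompact_Icc.inter_left (isClosed_setOf_lpFeasible A c)
  have hcont : Continuous (lpObjective A) :=
    continuous_finsetSum _ fun j _ => continuous_const.mul (continuous_apply j)
  obtain ⟨ξ, hξ, hmax⟩ := hcomp.exists_isMaxOn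
    ⟨c, lpFeasible_self hc, fun j => hc.1.1 j, hcK⟩ hcont.continuousOn
  refine ⟨ξ, hξ.1, fun η hη => ?_⟩
  rw [← hcutO η hη]
  exact hmax ⟨hcutF η hη, fun j => (hcutF η hη).nonneg j, fun j => min_le_right _ _⟩

end

end MultipleTesting

theorem mainTheorem3 (s : Stepping) (n : ℕ) (γ : ℝ) (hγ₀ : 0 ≤ γ) (hγ₁ : γ < 1)
    (c : Fin n → ℝ) (hc : c ∈ feasibleConstants (fdpMatrix s n γ)) :
    (∃ ξ, IsModifiedProcedure (fdpMatrix s n γ) c ξ) ∧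
    ∀ ξ, IsModifiedProcedure (fdpMatrix s n γ) c ξ →
      ξ ∈ feasibleConstants (fdpMatrix s n γ) ∧
      ∀ α : ℝ, 0 < α → α < 1 →
        α • ξ ∈ fdpControlling.{u} s n α γ ∧ AtLeastAsPowerful.{u} s (α • ξ) (α • c) := by
  have hA := fdpMatrix_nonneg s n γ
  refine ⟨exists_isModifiedProcedure hA hc, fun ξ hξ =>
    ⟨hξ.feasible.mem_feasibleConstants hA, fun α hα _ => ⟨?_, ?_⟩⟩⟩
  · refine mem_fdpControlling_of_mulVec_le hγ₀ hγ₁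
      ⟨fun i => mul_nonneg hα.le (hξ.feasible.nonneg i),
        fun a b hab => mul_le_mul_of_nonneg_left (hξ.feasible.mono hab) hα.le⟩ fun i => ?_
    rw [Matrix.mulVec_smul]
    exact mul_le_of_le_one_right hα.le (hξ.feasible.mulVec_le i)
  · exact atLeastAsPowerful_of_le s fun i => mul_le_mul_of_nonneg_left (hξ.feasible.ge i) hα.le
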